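/- Fix a continuous Riemannian metric on $\mathbb{T}^3=\mathbb{R}^3/\mathbb{Z}^3$, with norm $\|\cdot\|$ on tangent vectors, and let $f:\mathbb{T}^3\to\mathbb{T}^3$ be a $C^2$ diffeomorphism that is (absolutely) partially hyperbolic: there are a $Df$-invariant splitting $T\mathbb{T}^3=E^s\oplus E^c\oplus E^u$ into one-dimensional bundles and constants $C>0$ and $0<\nu_-\le\nu_+<\mu_-\le 1\le\mu_+<\lambda_-\le\lambda_+$ such that for all $x\in\mathbb{T}^3$ and all integers $n\ge 0$ $$\tfrac1C\nu_-^n\|v\|\le\|Df^n(x)v\|\le C\nu_+^n\|v\|\quad (v\in E^s(x)),$$ $$\tfrac1C\mu_-^n\|v\|\le\|Df^n(x)v\|\le C\mu_+^n\|v\|\quad (v\in E^c(x)),$$ $$\tfrac1C\lambda_-^n\|v\|\le\|Df^n(x)v\|\le C\lambda_+^n\|v\|\quad (v\in E^u(x)).$$ For $\sigma\in\{s,u\}$ let $J^\sigma f(x)=\|Df(x)|_{E^\sigma(x)}\|$ and, whenever the product (the limit of its partial products) converges, put $$\Delta^u(x,y)=\prod_{i=1}^{\infty}\frac{J^uf(f^{-i}(x))}{J^uf(f^{-i}(y))},\qquad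 \Delta^s(x,y)=\prod_{i=0}^{\infty}\frac{J^sf(f^{i}(x))}{J^sf(f^{i}(y))}.$$ Let $\sigma\in\{s,u\}$, and suppose that there are a dense subset $D\subset\mathbb{T}^3$ and a constant $K>1$ such that for all $y_1,y_2\in D$ and all integers $n\ge 0$ the product $\Delta^\sigma(f^n(y_1),f^n(y_2))$ converges and $$K^{-1}\le\Delta^\sigma(f^n(y_1),f^n(y_2))\le K .$$ Then all periodic points of $f$ have the same Lyapunov exponent in the $E^\sigma$-direction: there is $\lambda\in\mathbb{R}$ such that $\lim_{n\to\infty}\frac1n\log\|Df^n(p)v\|=\lambda$ for every periodic point $p$ of $f$ and every $0\ne v\in E^\sigma(p)$. -/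

import Mathlib

open Filter Topology

noncomputable section

namespace PHTorus

/-- The tangent space of the three-torus at any of its points (the torus is parallelised by its
translations). -/
abbrev V : Type := Fin 3 → ℝ

/-- The three-torus `ℝ³ / ℤ³`. -/
abbrev T3 : Type := UnitAddTorus (Fin 3)

/-- The quotient map `ℝ³ → ℝ³ / ℤ³`. -/
def proj (v : V) : T3 := fun i => (v i : UnitAddCircle)

/-- The representative of a point of the torus in the cube `(-1/2, 1/2]³`; it is a section of
`proj`, and inverts `proj` near `0`. -/
def rep (x : T3) : V := fun i => (AddCircle.equivIoc (1 : ℝ) (-1 / 2) (x i) : ℝ)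

/-- The expression of `f` near `p` in the charts `v ↦ p + proj v` at `p` and
`w ↦ f p + proj w` at `f p`; it sends `0` to `0`. -/
def inCharts (f : T3 → T3) (p : T3) (v : V) : V := rep (f (p + proj v) - f p)

/-- `f` is of class `C²`. -/
def IsC2 (f : T3 → T3) : Prop := ∀ p, ContDiffAt ℝ 2 (inCharts f p) 0

/-- `f` is a `C²` diffeomorphism. -/
def IsC2Diffeo (f : T3 ≃ T3) : Prop := IsC2 f ∧ IsC2 f.symm

/-- The derivative `Df(p) : T_p 𝕋³ → T_{f p} 𝕋³`. -/
def D (f : T3 → T3) (p : T3) : V →L[ℝ] V := fderiv ℝ (inCharts f p) 0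

/-- A continuous Riemannian metric on the torus. -/
structure RiemannianMetric where
  inner : T3 → V →L[ℝ] V →L[ℝ] ℝ
  continuous_inner : Continuous inner
  symm : ∀ p v w, inner p v w = inner p w v
  pos : ∀ p v, v ≠ 0 → 0 < inner p v v

/-- The length of the tangent vector `v` at `p`. -/
def RiemannianMetric.norm (g : RiemannianMetric) (p : T3) (v : V) : ℝ :=
  Real.sqrt (g.inner p v v)

/-- The labels of the three invariant bundles: stable, central, unstable. -/
inductive Label : Type
  | s
  | c
  | u
  deriving DecidableEq

/-- `T𝕋³ = E^s ⊕ E^c ⊕ E^u` is an absolutely partially hyperbolic splitting for `f` into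
line bundles. -/
structure IsPartiallyHyperbolicSplitting (g : RiemannianMetric) (f : T3 → T3)
    (E : Label → T3 → Submodule ℝ V) : Prop where
  finrank_eq_one : ∀ τ p, Module.finrank ℝ (E τ p) = 1
  isInternal : ∀ p, DirectSum.IsInternal fun τ => E τ p
  map_eq : ∀ τ p, (E τ p).map (D f p).toLinearMap = E τ (f p)
  exists_rates : ∃ C ν₁ ν₂ μ₁ μ₂ l₁ l₂ : ℝ,
    0 < C ∧ 0 < ν₁ ∧ ν₁ ≤ ν₂ ∧ ν₂ < μ₁ ∧ μ₁ ≤ 1 ∧ 1 ≤ μ₂ ∧ μ₂ < l₁ ∧ l₁ ≤ l₂ ∧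
    ∀ (n : ℕ) (p : T3),
      (∀ v ∈ E Label.s p, 1 / C * ν₁ ^ n * g.norm p v ≤ g.norm (f^[n] p) (D f^[n] p v) ∧
        g.norm (f^[n] p) (D f^[n] p v) ≤ C * ν₂ ^ n * g.norm p v) ∧
      (∀ v ∈ E Label.c p, 1 / C * μ₁ ^ n * g.norm p v ≤ g.norm (f^[n] p) (D f^[n] p v) ∧
        g.norm (f^[n] p) (D f^[n] p v) ≤ C * μ₂ ^ n * g.norm p v) ∧
      (∀ v ∈ E Label.u p, 1 / C * l₁ ^ n * g.norm p v ≤ g.norm (f^[n] p) (D f^[n] p v) ∧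
        g.norm (f^[n] p) (D f^[n] p v) ≤ C * l₂ ^ n * g.norm p v)

/-- The Jacobian of `f` at `p` along the line `L`: the norm of `Df(p)|L`. -/
def jacobian (g : RiemannianMetric) (f : T3 → T3) (L : T3 → Submodule ℝ V) (p : T3) : ℝ :=
  sSup {r : ℝ | ∃ v ∈ L p, g.norm p v = 1 ∧ r = g.norm (f p) (D f p v)}

/-- `Δ^s(x, y) = d`: the product `∏_{i ≥ 0} J^s f(f^i x) / J^s f(f^i y)` converges to `d`. -/
def HasDeltaS (g : RiemannianMetric) (f : T3 ≃ T3) (L : T3 → Submodule ℝ V) (x y : T3)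
    (d : ℝ) : Prop :=
  Tendsto (fun N : ℕ => ∏ i ∈ Finset.range N,
    jacobian g f L (f^[i] x) / jacobian g f L (f^[i] y)) atTop (𝓝 d)

/-- `Δ^u(x, y) = d`: the product `∏_{i ≥ 1} J^u f(f^{-i} x) / J^u f(f^{-i} y)` converges
to `d`. -/
def HasDeltaU (g : RiemannianMetric) (f : T3 ≃ T3) (L : T3 → Submodule ℝ V) (x y : T3)
    (d : ℝ) : Prop :=
  Tendsto (fun N : ℕ => ∏ i ∈ Finset.Icc 1 N,
    jacobian g f L (f.symm^[i] x) / jacobian g f L (f.symm^[i] y)) atTop (𝓝 d)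

/-- `Δ^σ(x, y) = d`; on the central bundle the formula of the unstable one is used. -/
def HasDelta (g : RiemannianMetric) (f : T3 ≃ T3) (E : Label → T3 → Submodule ℝ V) :
    Label → T3 → T3 → ℝ → Prop
  | Label.s => HasDeltaS g f (E Label.s)
  | Label.c => HasDeltaU g f (E Label.c)
  | Label.u => HasDeltaU g f (E Label.u)

/-- The Lyapunov exponent of `f` at `p` along the line `L` exists and equals `l`. -/
def HasLyapunovExponent (g : RiemannianMetric) (f : T3 → T3) (L : T3 → Submodule ℝ V) (p : T3)
    (l : ℝ) : Prop :=
  ∀ v ∈ L p, v ≠ 0 →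
    Tendsto (fun n : ℕ => 1 / (n : ℝ) * Real.log (g.norm (f^[n] p) (D f^[n] p v))) atTop (𝓝 l)

end PHTorus

end

/-! Write `J` for the Jacobian along `E σ` and `J_n(x)` for the product of `J` over the first `n`
points of the orbit of `x`. Shifting the infinite products by `n` gives `Δ^u(f^n x, f^n y) =
J_n(x)/J_n(y) · Δ^u(x, y)` and `Δ^s(x, y) = J_n(x)/J_n(y) · Δ^s(f^n x, f^n y)` (`HasDeltaU.iterate`,
`HasDeltaS.of_iterate`). The bounds on `Δ` therefore give `J_n(x)/J_n(y) ≤ K²` on the dense set,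
uniformly in `n`.

Continuity of the bundle is not assumed; domination forces it (`isClosed_of_dominated`). Hence `J`
is continuous (`continuous_jacobian`) and the bound extends to all points. The Birkhoff sums `log
J_n` then differ between any two points by a bounded amount, so their averages have one common limit
by Fekete's lemma (`exists_tendsto_birkhoffAverage`). On a line bundle this limit is the Lyapunov
exponent, at every point of the torus, periodic or not. -/

namespace PHTorus

/-! ### Charts of the torus and derivatives -/

theorem proj_rep (x : T3) : proj (rep x) = x := by
  funext i
  exact AddCircle.coe_equivIoc

theorem rep_proj {v : V} (hv : ‖v‖ < 1 / 2) : rep (proj v) = v := by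
  funext i
  have h := (norm_le_pi_norm v i).trans_lt hv
  rw [Real.norm_eq_abs, abs_lt] at h
  refine AddCircle.equivIoc_coe_of_mem ⟨by linarith [h.1], by linarith [h.2]⟩

theorem proj_zero : proj 0 = 0 := by
  funext i
  simp [proj]

theorem proj_add (v w : V) : proj (v + w) = proj v + proj w := by
  funext i
  simp [proj]

theorem proj_sub (v w : V) : proj (v - w) = proj v - proj w := by
  funext i
  simp [proj]

theorem rep_zero : rep 0 = 0 := by
  rw [← proj_zero]
  exact rep_proj (by norm_num)

theorem continuous_proj : Continuous proj :=
  continuous_pi fun i => (AddCircle.continuous_mk' 1).comp (continuous_apply i)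

theorem continuousAt_rep_zero : ContinuousAt rep 0 := by
  refine continuousAt_pi.2 fun i => ?_
  have h0 : (0 : UnitAddCircle) ≠ ((-1 / 2 : ℝ) : UnitAddCircle) := by
    intro h
    have h' := (AddCircle.coe_eq_zero_iff (1 : ℝ)).1 h.symm
    obtain ⟨n, hn⟩ := h'
    have h2 : (2 * n : ℝ) = -1 := by
      simp at hn
      linarith
    have h3 : 2 * n = -1 := by exact_mod_cast h2
    omega
  have h1 : ContinuousAt (AddCircle.equivIoc (1 : ℝ) (-1 / 2)) ((0 : T3) i) :=
    AddCircle.continuousAt_equivIoc (1 : ℝ) (-1 / 2) h0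
  exact continuousAt_subtype_val.comp
    (h1.comp (f := fun x : T3 => x i) (continuous_apply i).continuousAt)

theorem rep_sub {x y : T3} (hx : ‖rep x‖ < 1 / 4) (hy : ‖rep y‖ < 1 / 4) :
    rep (x - y) = rep x - rep y := by
  have h : ‖rep x - rep y‖ < 1 / 2 := by
    linarith [norm_sub_le (rep x) (rep y)]
  rw [← rep_proj h, proj_sub, proj_rep, proj_rep]

theorem continuousAt_rep_sub (p : T3) : ContinuousAt (fun x => rep (x - p)) p := by
  have h : ContinuousAt rep (p - p) := by
    rw [sub_self]
    exact continuousAt_rep_zero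
  exact h.comp (f := fun x => x - p) (by fun_prop)

theorem inCharts_zero (f : T3 → T3) (p : T3) : inCharts f p 0 = 0 := by
  simp [inCharts, proj_zero, rep_zero]

theorem inCharts_rep_sub (f : T3 → T3) (p x : T3) :
    inCharts f p (rep (x - p)) = rep (f x - f p) := by
  simp [inCharts, proj_rep]

theorem proj_inCharts (f : T3 → T3) (p : T3) (v : V) :
    f p + proj (inCharts f p v) = f (p + proj v) := by
  simp [inCharts, proj_rep]

theorem inCharts_comp (f h : T3 → T3) (p : T3) :
    inCharts (f ∘ h) p = inCharts f (h p) ∘ inCharts h p := by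
  funext v
  simp only [Function.comp_apply]
  conv_rhs => rw [inCharts, proj_inCharts]
  rfl

theorem inCharts_id (p : T3) : inCharts id p =ᶠ[𝓝 0] id := by
  filter_upwards [Metric.ball_mem_nhds (0 : V) (by norm_num : (0 : ℝ) < 1 / 2)] with v hv
  rw [mem_ball_zero_iff] at hv
  simp [inCharts, rep_proj hv]

theorem isC2_id : IsC2 id := fun p => contDiffAt_id.congr_of_eventuallyEq (inCharts_id p)

theorem D_id (p : T3) : D id p = ContinuousLinearMap.id ℝ V := by
  rw [D, (inCharts_id p).fderiv_eq, fderiv_id]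

theorem IsC2.comp {f h : T3 → T3} (hf : IsC2 f) (hh : IsC2 h) : IsC2 (f ∘ h) := by
  intro p
  rw [inCharts_comp]
  refine ContDiffAt.comp 0 ?_ (hh p)
  rw [inCharts_zero]
  exact hf (h p)

theorem IsC2.iterate {f : T3 → T3} (hf : IsC2 f) (n : ℕ) : IsC2 f^[n] := by
  induction n with
  | zero => exact isC2_id
  | succ n ih => exact ih.comp hf

theorem IsC2.differentiableAt {f : T3 → T3} (hf : IsC2 f) (p : T3) :
    DifferentiableAt ℝ (inCharts f p) 0 :=
  (hf p).differentiableAt (by norm_num)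

theorem D_comp {f h : T3 → T3} (hf : IsC2 f) (hh : IsC2 h) (p : T3) :
    D (f ∘ h) p = (D f (h p)).comp (D h p) := by
  have h1 : DifferentiableAt ℝ (inCharts f (h p)) (inCharts h p 0) := by
    rw [inCharts_zero]
    exact hf.differentiableAt _
  rw [D, inCharts_comp, fderiv_comp 0 h1 (hh.differentiableAt p), inCharts_zero]
  rfl

theorem IsC2.continuous {f : T3 → T3} (hf : IsC2 f) : Continuous f := by
  refine continuous_iff_continuousAt.2 fun p => ?_
  have h1 : f = fun x => f p + proj (inCharts f p (rep (x - p))) := by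
    funext x
    rw [inCharts_rep_sub, proj_rep]
    abel
  have h2 : ContinuousAt (inCharts f p) (rep (p - p)) := by
    rw [sub_self, rep_zero]
    exact (hf p).continuousAt
  have h3 : ContinuousAt (fun x => inCharts f p (rep (x - p))) p :=
    ContinuousAt.comp (f := fun x => rep (x - p)) h2 (continuousAt_rep_sub p)
  rw [h1]
  exact continuousAt_const.add (continuous_proj.continuousAt.comp h3)

/-- `D f x` is defined in a chart that moves with `x`. Charts at nearby points differ by
translations, so near `p` it is the derivative of one fixed `C²` map; this is what makes `D f`
continuous. -/
theorem D_eq_fderiv_inCharts {f : T3 → T3} (hf : IsC2 f) (p : T3) :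
    ∀ᶠ x in 𝓝 p, D f x = fderiv ℝ (inCharts f p) (rep (x - p)) := by
  have hsmall : ∀ᶠ v in 𝓝 (0 : V), ‖inCharts f p v‖ < 1 / 4 := by
    have h : ContinuousAt (fun v => ‖inCharts f p v‖) 0 := (hf p).continuousAt.norm
    refine h.eventually_lt_const ?_
    simp [inCharts_zero]
  have hrep : Tendsto (fun x => rep (x - p)) (𝓝 p) (𝓝 0) := by
    have := continuousAt_rep_sub p
    rwa [ContinuousAt, sub_self, rep_zero] at this
  filter_upwards [hrep.eventually hsmall.eventually_nhds] with x hx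
  set v := rep (x - p) with hv
  have hxv : x = p + proj v := by rw [hv, proj_rep]; abel
  have hshift : Tendsto (fun w : V => v + w) (𝓝 0) (𝓝 v) := by
    have : Continuous fun w : V => v + w := by fun_prop
    simpa using this.tendsto 0
  have hev : inCharts f x =ᶠ[𝓝 0] fun w => inCharts f p (v + w) - inCharts f p v := by
    filter_upwards [hshift.eventually hx] with w hw
    have h := rep_sub hw hx.self_of_nhds
    simp only [inCharts]
    rw [← h, hxv, proj_add, add_assoc, sub_sub_sub_cancel_right]
  rw [D, hev.fderiv_eq, fderiv_sub_const, fderiv_comp_add_left, add_zero]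

theorem IsC2.continuous_D {f : T3 → T3} (hf : IsC2 f) : Continuous (D f) := by
  refine continuous_iff_continuousAt.2 fun p => ?_
  have h2 : ContinuousAt (fderiv ℝ (inCharts f p)) (rep (p - p)) := by
    rw [sub_self, rep_zero]
    exact ((hf p).fderiv_right (m := 1) (by norm_num)).continuousAt
  have h3 : ContinuousAt (fun x => fderiv ℝ (inCharts f p) (rep (x - p))) p :=
    ContinuousAt.comp (f := fun x => rep (x - p)) h2 (continuousAt_rep_sub p)
  exact h3.congr ((D_eq_fderiv_inCharts hf p).mono fun _ h => h.symm)

/-! ### The Riemannian norm -/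

theorem RiemannianMetric.norm_pos (g : RiemannianMetric) (p : T3) {v : V} (hv : v ≠ 0) :
    0 < g.norm p v :=
  Real.sqrt_pos.2 (g.pos p v hv)

theorem RiemannianMetric.norm_smul (g : RiemannianMetric) (p : T3) (c : ℝ) (v : V) :
    g.norm p (c • v) = |c| * g.norm p v := by
  simp only [RiemannianMetric.norm, map_smul, smul_apply, smul_eq_mul]
  rw [← mul_assoc, Real.sqrt_mul (mul_self_nonneg c), Real.sqrt_mul_self_eq_abs]

theorem RiemannianMetric.continuous_norm (g : RiemannianMetric) :
    Continuous fun x : T3 × V => g.norm x.1 x.2 := by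
  have h := g.continuous_inner
  unfold RiemannianMetric.norm
  fun_prop

/-- By homogeneity it suffices to bound the norm on the compact unit sphere bundle. -/
theorem RiemannianMetric.exists_norm_equiv (g : RiemannianMetric) :
    ∃ m M : ℝ, 0 < m ∧ 0 < M ∧ ∀ p v, m * ‖v‖ ≤ g.norm p v ∧ g.norm p v ≤ M * ‖v‖ := by
  have hK : IsCompact ((Set.univ : Set T3) ×ˢ Metric.sphere (0 : V) 1) :=
    isCompact_univ.prod (isCompact_sphere 0 1)
  have hne : ((Set.univ : Set T3) ×ˢ Metric.sphere (0 : V) 1).Nonempty :=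
    Set.univ_nonempty.prod (NormedSpace.sphere_nonempty.2 zero_le_one)
  obtain ⟨a, ha, hamin⟩ := hK.exists_isMinOn hne g.continuous_norm.continuousOn
  obtain ⟨b, hb, hbmax⟩ := hK.exists_isMaxOn hne g.continuous_norm.continuousOn
  have hne0 : ∀ x ∈ (Set.univ : Set T3) ×ˢ Metric.sphere (0 : V) 1, x.2 ≠ 0 := by
    rintro ⟨x, v⟩ ⟨-, hv⟩ (rfl : v = 0)
    simp at hv
  refine ⟨g.norm a.1 a.2, g.norm b.1 b.2, g.norm_pos _ (hne0 a ha), g.norm_pos _ (hne0 b hb), ?_⟩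
  intro p v
  rcases eq_or_ne v 0 with rfl | hv
  · simp [RiemannianMetric.norm]
  have hmem : (p, ‖v‖⁻¹ • v) ∈ (Set.univ : Set T3) ×ˢ Metric.sphere (0 : V) 1 := by
    simp [_root_.norm_smul, hv]
  have hvv : v = ‖v‖ • (‖v‖⁻¹ • v) := by
    rw [smul_smul, mul_inv_cancel₀ (norm_ne_zero_iff.2 hv), one_smul]
  have h1 : g.norm p v = ‖v‖ * g.norm p (‖v‖⁻¹ • v) := by
    conv_lhs => rw [hvv]
    rw [g.norm_smul, abs_norm]
  have h2 := hamin hmem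
  have h3 := hbmax hmem
  simp only [Set.mem_ofPred_eq] at h2 h3
  rw [h1, mul_comm _ ‖v‖, mul_comm _ ‖v‖]
  exact ⟨by gcongr, by gcongr⟩

/-! ### Continuity of dominated line bundles -/

theorem nonpos_of_pow_mul_le {a b x B : ℝ} (ha : 0 ≤ a) (hab : a < b)
    (h : ∀ n : ℕ, b ^ n * x ≤ B * a ^ n) : x ≤ 0 := by
  have hb : 0 < b := ha.trans_lt hab
  have h1 : Tendsto (fun n : ℕ => B * (a / b) ^ n) atTop (𝓝 (B * 0)) :=
    (tendsto_pow_atTop_nhds_zero_of_lt_one (div_nonneg ha hb.le)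
      ((div_lt_one hb).2 hab)).const_mul B
  rw [mul_zero] at h1
  refine ge_of_tendsto' h1 fun n => ?_
  rw [div_pow, mul_div_assoc', le_div_iff₀ (pow_pos hb n), mul_comm]
  exact h n

/-- If a sum of vectors is contracted as fast as its first summand, the other two summands, which
are expanded at faster and mutually separated rates, vanish. -/
theorem eq_zero_of_contracted {A : ℕ → V →L[ℝ] V} {v₁ v₂ v₃ : V} {C a b₁ b₂ d : ℝ}
    (hC : 0 < C) (ha : 0 ≤ a) (hab : a < b₁) (hb : b₁ ≤ b₂) (hbd : b₂ < d)
    (hsum : ∀ n, ‖A n (v₁ + v₂ + v₃)‖ ≤ C * a ^ n * ‖v₁ + v₂ + v₃‖)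
    (h₁ : ∀ n, ‖A n v₁‖ ≤ C * a ^ n * ‖v₁‖)
    (h₂ : ∀ n, b₁ ^ n * ‖v₂‖ ≤ C * ‖A n v₂‖)
    (h₂' : ∀ n, ‖A n v₂‖ ≤ C * b₂ ^ n * ‖v₂‖)
    (h₃ : ∀ n, d ^ n * ‖v₃‖ ≤ C * ‖A n v₃‖) : v₂ = 0 ∧ v₃ = 0 := by
  have hab₂ : a ≤ b₂ := hab.le.trans hb
  -- The fastest summand goes first: all other terms are `O(b₂ ^ n)` with `b₂ < d`. Once it is gone,
  -- `v₂` is compared with `a ^ n` in the same way.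
  have hv₃ : v₃ = 0 := by
    refine norm_le_zero_iff.1 (nonpos_of_pow_mul_le (ha.trans (hab.le.trans hb)) hbd
      (B := C * (C * ‖v₁ + v₂ + v₃‖ + C * ‖v₁‖ + C * ‖v₂‖)) fun n => (h₃ n).trans ?_)
    have e : A n v₃ = A n (v₁ + v₂ + v₃) - A n v₁ - A n v₂ := by
      rw [map_add, map_add]; abel
    have e1 : ‖A n v₃‖ ≤ ‖A n (v₁ + v₂ + v₃)‖ + ‖A n v₁‖ + ‖A n v₂‖ := by
      rw [e]
      exact (norm_sub_le _ _).trans (add_le_add_left (norm_sub_le _ _) _)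
    have e2 : ‖A n (v₁ + v₂ + v₃)‖ ≤ C * b₂ ^ n * ‖v₁ + v₂ + v₃‖ :=
      (hsum n).trans (by gcongr)
    have e3 : ‖A n v₁‖ ≤ C * b₂ ^ n * ‖v₁‖ := (h₁ n).trans (by gcongr)
    calc C * ‖A n v₃‖ ≤ C * (C * b₂ ^ n * ‖v₁ + v₂ + v₃‖ + C * b₂ ^ n * ‖v₁‖
          + C * b₂ ^ n * ‖v₂‖) := by
          gcongr
          linarith [h₂' n]
      _ = _ := by ring
  subst hv₃
  refine ⟨norm_le_zero_iff.1 (nonpos_of_pow_mul_le ha hab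
      (B := C * (C * ‖v₁ + v₂ + 0‖ + C * ‖v₁‖)) fun n => (h₂ n).trans ?_), rfl⟩
  have e : A n v₂ = A n (v₁ + v₂ + 0) - A n v₁ := by
    rw [add_zero, map_add]; abel
  calc C * ‖A n v₂‖ ≤ C * (C * a ^ n * ‖v₁ + v₂ + 0‖ + C * a ^ n * ‖v₁‖) := by
        gcongr
        rw [e]
        exact (norm_sub_le _ _).trans (add_le_add (hsum n) (h₁ n))
    _ = _ := by ring

/-- `E₁` consists exactly of the vectors contracted at rate `a` with constant `C` at all times, and
for each `n` this is a closed condition on `(p, v)`. -/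
theorem isClosed_of_dominated {h : T3 → T3} (hh : IsC2 h) {E₁ E₂ E₃ : T3 → Submodule ℝ V}
    (hE : ∀ p v, ∃ v₁ ∈ E₁ p, ∃ v₂ ∈ E₂ p, ∃ v₃ ∈ E₃ p, v = v₁ + v₂ + v₃) {C a b₁ b₂ d : ℝ}
    (hC : 0 < C) (ha : 0 ≤ a) (hab : a < b₁) (hb : b₁ ≤ b₂) (hbd : b₂ < d)
    (h₁ : ∀ n p, ∀ v ∈ E₁ p, ‖D h^[n] p v‖ ≤ C * a ^ n * ‖v‖)
    (h₂ : ∀ n p, ∀ v ∈ E₂ p, b₁ ^ n * ‖v‖ ≤ C * ‖D h^[n] p v‖)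
    (h₂' : ∀ n p, ∀ v ∈ E₂ p, ‖D h^[n] p v‖ ≤ C * b₂ ^ n * ‖v‖)
    (h₃ : ∀ n p, ∀ v ∈ E₃ p, d ^ n * ‖v‖ ≤ C * ‖D h^[n] p v‖) :
    IsClosed {x : T3 × V | x.2 ∈ E₁ x.1} := by
  have heq : {x : T3 × V | x.2 ∈ E₁ x.1} =
      ⋂ n : ℕ, {x : T3 × V | ‖D h^[n] x.1 x.2‖ ≤ C * a ^ n * ‖x.2‖} := by
    ext ⟨p, v⟩
    simp only [Set.mem_iInter, Set.mem_ofPred_eq]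
    refine ⟨fun hv n => h₁ n p v hv, fun hv => ?_⟩
    obtain ⟨v₁, hv₁, v₂, hv₂, v₃, hv₃, rfl⟩ := hE p v
    obtain ⟨rfl, rfl⟩ := eq_zero_of_contracted (A := fun n => D h^[n] p) hC ha hab hb hbd hv
      (fun n => h₁ n p _ hv₁) (fun n => h₂ n p _ hv₂) (fun n => h₂' n p _ hv₂)
      (fun n => h₃ n p _ hv₃)
    simpa using hv₁
  rw [heq]
  refine isClosed_iInter fun n => isClosed_le ?_ (by fun_prop)
  have := (hh.iterate n).continuous_D
  fun_prop

section Splitting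

variable {g : RiemannianMetric} {f : T3 ≃ T3} {E : Label → T3 → Submodule ℝ V}

theorem IsPartiallyHyperbolicSplitting.exists_add {f : T3 → T3}
    (hE : IsPartiallyHyperbolicSplitting g f E) (p : T3) (v : V) :
    ∃ v₁ ∈ E Label.s p, ∃ v₂ ∈ E Label.c p, ∃ v₃ ∈ E Label.u p, v = v₁ + v₂ + v₃ := by
  have htop : v ∈ E Label.s p ⊔ E Label.c p ⊔ E Label.u p := by
    have h : (⨆ τ, E τ p) ≤ E Label.s p ⊔ E Label.c p ⊔ E Label.u p := by
      refine iSup_le fun τ => ?_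
      cases τ
      · exact le_sup_left.trans le_sup_left
      · exact le_sup_right.trans le_sup_left
      · exact le_sup_right
    rw [(hE.isInternal p).submodule_iSup_eq_top] at h
    exact h Submodule.mem_top
  obtain ⟨w, hw, v₃, hv₃, rfl⟩ := Submodule.mem_sup.1 htop
  obtain ⟨v₁, hv₁, v₂, hv₂, rfl⟩ := Submodule.mem_sup.1 hw
  exact ⟨v₁, hv₁, v₂, hv₂, v₃, hv₃, rfl⟩

theorem D_symm_iterate_apply (hf : IsC2Diffeo f) (n : ℕ) (q : T3) (w : V) :
    D f.symm^[n] (f^[n] q) (D f^[n] q w) = w := by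
  have h : f.symm^[n] ∘ f^[n] = id := by
    funext x
    exact (Function.LeftInverse.iterate f.left_inv n) x
  have h' := D_comp (hf.2.iterate n) (hf.1.iterate n) q
  rw [h, D_id] at h'
  exact (congrArg (fun A : V →L[ℝ] V => A w) h').symm

theorem D_ne_zero (hf : IsC2Diffeo f) (p : T3) {v : V} (hv : v ≠ 0) : D f p v ≠ 0 := by
  intro h
  have h' := D_symm_iterate_apply hf 1 p v
  simp only [Function.iterate_one, h, map_zero] at h'
  exact hv h'.symm

theorem map_iterate_eq {f : T3 → T3} (hf : IsC2 f) {L : T3 → Submodule ℝ V}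
    (hL : ∀ p, (L p).map (D f p).toLinearMap = L (f p)) (n : ℕ) (p : T3) :
    (L p).map (D f^[n] p).toLinearMap = L (f^[n] p) := by
  induction n with
  | zero =>
    have h : D f^[0] p = ContinuousLinearMap.id ℝ V := D_id p
    rw [h]
    exact Submodule.map_id _
  | succ n ih =>
    rw [Function.iterate_succ', D_comp hf (hf.iterate n), Function.comp_apply, ← hL, ← ih,
      ← Submodule.map_comp]
    rfl

/-- A vector of an invariant bundle is the image of its preimage in the bundle. -/
theorem exists_preimage_iterate (hf : IsC2Diffeo f) {L : T3 → Submodule ℝ V}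
    (hL : ∀ p, (L p).map (D f p).toLinearMap = L (f p)) (n : ℕ) (p : T3) {v : V}
    (hv : v ∈ L p) :
    D f.symm^[n] p v ∈ L (f.symm^[n] p) ∧
      D f^[n] (f.symm^[n] p) (D f.symm^[n] p v) = v := by
  obtain ⟨q, rfl⟩ : ∃ q, p = f^[n] q :=
    ⟨f.symm^[n] p, ((Function.LeftInverse.iterate f.right_inv n) p).symm⟩
  have hq : f.symm^[n] (f^[n] q) = q := (Function.LeftInverse.iterate f.left_inv n) q
  rw [← map_iterate_eq hf.1 hL] at hv
  obtain ⟨w, hw, rfl⟩ := hv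
  simp only [ContinuousLinearMap.coe_coe]
  rw [D_symm_iterate_apply hf, hq]
  exact ⟨hw, rfl⟩

theorem IsPartiallyHyperbolicSplitting.exists_rates_supNorm {f : T3 → T3}
    (hE : IsPartiallyHyperbolicSplitting g f E) :
    ∃ C ν μ₁ μ₂ l : ℝ, 0 < C ∧ 0 < ν ∧ ν < μ₁ ∧ μ₁ ≤ μ₂ ∧ μ₂ < l ∧ ∀ (n : ℕ) (p : T3),
      (∀ v ∈ E Label.s p, ‖D f^[n] p v‖ ≤ C * ν ^ n * ‖v‖) ∧
      (∀ v ∈ E Label.c p, μ₁ ^ n * ‖v‖ ≤ C * ‖D f^[n] p v‖ ∧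
        ‖D f^[n] p v‖ ≤ C * μ₂ ^ n * ‖v‖) ∧
      (∀ v ∈ E Label.u p, l ^ n * ‖v‖ ≤ C * ‖D f^[n] p v‖) := by
  obtain ⟨C, ν₁, ν₂, μ₁, μ₂, l₁, l₂, hC, hν₁, hν, hνμ, hμ₁, hμ₂, hμl, -, H⟩ := hE.exists_rates
  obtain ⟨m, M, hm, hM, hmM⟩ := g.exists_norm_equiv
  have upper : ∀ (r : ℝ) (p q : T3) (v w : V), 0 ≤ r → g.norm q w ≤ C * r * g.norm p v →
      ‖w‖ ≤ C * M / m * r * ‖v‖ := by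
    intro r p q v w hr h
    have h1 : m * ‖w‖ ≤ C * r * (M * ‖v‖) :=
      (hmM q w).1.trans (h.trans (by gcongr; exact (hmM p v).2))
    have h2 : C * M / m * r * ‖v‖ = (C * r * (M * ‖v‖)) / m := by ring
    rw [h2, le_div_iff₀ hm]
    linarith
  have lower : ∀ (r : ℝ) (p q : T3) (v w : V), 0 ≤ r → 1 / C * r * g.norm p v ≤ g.norm q w →
      r * ‖v‖ ≤ C * M / m * ‖w‖ := by
    intro r p q v w hr h
    have h1 : 1 / C * r * (m * ‖v‖) ≤ M * ‖w‖ :=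
      le_trans (by gcongr; exact (hmM p v).1) (h.trans (hmM q w).2)
    have h2 : 1 / C * r * (m * ‖v‖) = (r * (m * ‖v‖)) / C := by ring
    rw [h2, div_le_iff₀ hC] at h1
    have h3 : C * M / m * ‖w‖ = (M * ‖w‖ * C) / m := by ring
    rw [h3, le_div_iff₀ hm]
    linarith
  have hν₂ : 0 < ν₂ := hν₁.trans_le hν
  have hμ₁' : 0 < μ₁ := hν₂.trans hνμ
  refine ⟨C * M / m, ν₂, μ₁, μ₂, l₁, by positivity, hν₂, hνμ, hμ₁.trans hμ₂, hμl,
    fun n p => ⟨fun v hv => ?_, fun v hv => ⟨?_, ?_⟩, fun v hv => ?_⟩⟩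
  · exact upper _ p _ v _ (by positivity) ((H n p).1 v hv).2
  · exact lower _ p _ v _ (by positivity) ((H n p).2.1 v hv).1
  · exact upper _ p _ v _ (by positivity) ((H n p).2.1 v hv).2
  · exact lower _ p _ v _ (pow_nonneg (by linarith) n) ((H n p).2.2 v hv).1

theorem IsPartiallyHyperbolicSplitting.isClosed_stable
    (hE : IsPartiallyHyperbolicSplitting g f E) (hf : IsC2Diffeo f) :
    IsClosed {x : T3 × V | x.2 ∈ E Label.s x.1} := by
  obtain ⟨C, ν, μ₁, μ₂, l, hC, hν, hνμ, hμ, hμl, H⟩ := hE.exists_rates_supNorm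
  exact isClosed_of_dominated hf.1 hE.exists_add hC hν.le hνμ hμ hμl
    (fun n p => (H n p).1) (fun n p v hv => ((H n p).2.1 v hv).1)
    (fun n p v hv => ((H n p).2.1 v hv).2) (fun n p => (H n p).2.2)

theorem IsPartiallyHyperbolicSplitting.isClosed_unstable
    (hE : IsPartiallyHyperbolicSplitting g f E) (hf : IsC2Diffeo f) :
    IsClosed {x : T3 × V | x.2 ∈ E Label.u x.1} := by
  obtain ⟨C, ν, μ₁, μ₂, l, hC, hν, hνμ, hμ, hμl, H⟩ := hE.exists_rates_supNorm
  have hμ₁ : 0 < μ₁ := hν.trans hνμ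
  have hμ₂ : 0 < μ₂ := hμ₁.trans_le hμ
  have hl : 0 < l := hμ₂.trans hμl
  have hdec : ∀ p v, ∃ v₁ ∈ E Label.u p, ∃ v₂ ∈ E Label.c p, ∃ v₃ ∈ E Label.s p,
      v = v₁ + v₂ + v₃ := by
    intro p v
    obtain ⟨v₁, h₁, v₂, h₂, v₃, h₃, rfl⟩ := hE.exists_add p v
    exact ⟨v₃, h₃, v₂, h₂, v₁, h₁, by abel⟩
  have upper : ∀ (r x y : ℝ), 0 < r → r * x ≤ C * y → x ≤ C * r⁻¹ * y := by
    intro r x y hr h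
    have e : C * r⁻¹ * y = C * y / r := by ring
    rw [e, le_div_iff₀ hr]
    linarith
  have lower : ∀ (r x y : ℝ), 0 < r → y ≤ C * r * x → r⁻¹ * y ≤ C * x := by
    intro r x y hr h
    rw [inv_mul_le_iff₀ hr]
    linarith
  have hpre := fun τ => exists_preimage_iterate hf (hE.map_eq τ)
  -- For `f⁻¹` the unstable bundle is the most contracted one: the rates are inverted and their
  -- order is reversed.
  refine isClosed_of_dominated (a := l⁻¹) (b₁ := μ₂⁻¹) (b₂ := μ₁⁻¹) (d := ν⁻¹) hf.2 hdec hC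
    (inv_nonneg.2 hl.le) (inv_strictAnti₀ hμ₂ hμl) (inv_anti₀ hμ₁ hμ) (inv_strictAnti₀ hν hνμ)
    ?_ ?_ ?_ ?_
  · intro n p v hv
    obtain ⟨h1, h2⟩ := hpre _ n p hv
    have h3 := (H n _).2.2 _ h1
    rw [h2] at h3
    rw [inv_pow]
    exact upper _ _ _ (pow_pos hl n) h3
  · intro n p v hv
    obtain ⟨h1, h2⟩ := hpre _ n p hv
    have h3 := ((H n _).2.1 _ h1).2
    rw [h2] at h3
    rw [inv_pow]
    exact lower _ _ _ (pow_pos hμ₂ n) h3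
  · intro n p v hv
    obtain ⟨h1, h2⟩ := hpre _ n p hv
    have h3 := ((H n _).2.1 _ h1).1
    rw [h2] at h3
    rw [inv_pow]
    exact upper _ _ _ (pow_pos hμ₁ n) h3
  · intro n p v hv
    obtain ⟨h1, h2⟩ := hpre _ n p hv
    have h3 := (H n _).1 _ h1
    rw [h2] at h3
    rw [inv_pow]
    exact lower _ _ _ (pow_pos hν n) h3

/-! ### The Jacobian along a continuous line bundle -/

variable {L : T3 → Submodule ℝ V}

theorem jacobian_eq {f : T3 → T3} {p : T3} (hL : Module.finrank ℝ (L p) = 1) {v : V}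
    (hv : v ∈ L p) (hv0 : v ≠ 0) :
    jacobian g f L p = g.norm (f p) (D f p v) / g.norm p v := by
  have hpos := g.norm_pos p hv0
  have hset : {r : ℝ | ∃ w ∈ L p, g.norm p w = 1 ∧ r = g.norm (f p) (D f p w)} =
      {g.norm (f p) (D f p v) / g.norm p v} := by
    ext r
    simp only [Set.mem_ofPred_eq, Set.mem_singleton_iff]
    constructor
    · rintro ⟨w, hw, hw1, rfl⟩
      obtain ⟨c, hc⟩ := exists_smul_eq_of_finrank_eq_one hL
        (x := (⟨v, hv⟩ : L p)) (by simpa using hv0) ⟨w, hw⟩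
      obtain rfl : c • v = w := congrArg Subtype.val hc
      rw [g.norm_smul] at hw1
      rw [map_smul, g.norm_smul, eq_div_iff hpos.ne']
      linear_combination g.norm (f p) (D f p v) * hw1
    · rintro rfl
      refine ⟨(g.norm p v)⁻¹ • v, (L p).smul_mem _ hv, ?_, ?_⟩
      · rw [g.norm_smul, abs_of_pos (inv_pos.2 hpos), inv_mul_cancel₀ hpos.ne']
      · rw [map_smul, g.norm_smul, abs_of_pos (inv_pos.2 hpos), div_eq_inv_mul]
  rw [jacobian, hset, csSup_singleton]

theorem exists_unit_mem {p : T3} (hL : Module.finrank ℝ (L p) = 1) :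
    ∃ v ∈ L p, ‖v‖ = 1 := by
  obtain ⟨⟨v, hv⟩, hv0, -⟩ := finrank_eq_one_iff'.1 hL
  have hv0 : v ≠ 0 := by simpa using hv0
  exact ⟨‖v‖⁻¹ • v, (L p).smul_mem _ hv, by simp [norm_smul, hv0]⟩

theorem jacobian_pos (hf : IsC2Diffeo f) {p : T3} (hL : Module.finrank ℝ (L p) = 1) :
    0 < jacobian g f L p := by
  obtain ⟨v, hv, hv1⟩ := exists_unit_mem hL
  have hv0 : v ≠ 0 := by
    rintro rfl
    simp at hv1
  rw [jacobian_eq hL hv hv0]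
  exact div_pos (g.norm_pos _ (D_ne_zero hf p hv0)) (g.norm_pos p hv0)

/-- A line bundle need not have a global continuous unit section. Instead `J` is pulled back to the
compact set `G` of unit vectors of `L`, where it has an explicit continuous formula; `G` maps onto
the torus by a closed map, hence a quotient map. -/
theorem continuous_jacobian {f : T3 → T3} (hf : IsC2 f)
    (hL : ∀ p, Module.finrank ℝ (L p) = 1) (hcl : IsClosed {x : T3 × V | x.2 ∈ L x.1}) :
    Continuous (jacobian g f L) := by
  let G : Set (T3 × V) := {x | x.2 ∈ L x.1} ∩ Set.univ ×ˢ Metric.sphere (0 : V) 1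
  have hG : IsCompact G := (isCompact_univ.prod (isCompact_sphere 0 1)).inter_left hcl
  have : CompactSpace G := isCompact_iff_compactSpace.1 hG
  let π : G → T3 := fun x => x.1.1
  have hπ : Continuous π := by fun_prop
  have hsurj : Function.Surjective π := by
    intro p
    obtain ⟨v, hv, hv1⟩ := exists_unit_mem (hL p)
    exact ⟨⟨(p, v), hv, Set.mem_univ _, by simpa using hv1⟩, rfl⟩
  have hq : IsQuotientMap π := hπ.isClosedMap.isQuotientMap hπ hsurj
  have hne : ∀ x : G, x.1.2 ≠ 0 := by
    rintro ⟨⟨p, v⟩, -, -, hv⟩ (rfl : v = 0)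
    simp at hv
  refine hq.continuous_iff.2 ?_
  have heq : jacobian g f L ∘ π = fun x : G =>
      g.norm (f x.1.1) (D f x.1.1 x.1.2) / g.norm x.1.1 x.1.2 :=
    funext fun x => jacobian_eq (hL _) x.2.1 (hne x)
  rw [heq]
  have hD := hf.continuous_D
  have hfc := hf.continuous
  refine Continuous.div ?_ ?_ fun x => (g.norm_pos _ (hne x)).ne'
  · exact g.continuous_norm.comp (f := fun x : G => (f x.1.1, D f x.1.1 x.1.2)) (by fun_prop)
  · exact g.continuous_norm.comp continuous_subtype_val

theorem norm_D_iterate {f : T3 → T3} (hf : IsC2 f) (hL : ∀ p, Module.finrank ℝ (L p) = 1)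
    (hmap : ∀ p, (L p).map (D f p).toLinearMap = L (f p)) (n : ℕ) (p : T3) {v : V}
    (hv : v ∈ L p) :
    g.norm (f^[n] p) (D f^[n] p v) =
      (∏ i ∈ Finset.range n, jacobian g f L (f^[i] p)) * g.norm p v := by
  induction n with
  | zero => simp [D_id]
  | succ n ih =>
    have hmem : D f^[n] p v ∈ L (f^[n] p) := by
      rw [← map_iterate_eq hf hmap]
      exact Submodule.mem_map_of_mem hv
    rw [Finset.prod_range_succ, mul_right_comm, ← ih, Function.iterate_succ',
      D_comp hf (hf.iterate n), Function.comp_apply, ContinuousLinearMap.comp_apply]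
    rcases eq_or_ne (D f^[n] p v) 0 with h0 | h0
    · simp [h0, RiemannianMetric.norm]
    · rw [jacobian_eq (hL _) hmem h0, mul_div_cancel₀ _ (g.norm_pos _ h0).ne']

end Splitting

/-! ### Birkhoff averages and products along orbits -/

/-- If the Birkhoff sums of `φ` depend on the starting point only up to a bounded error, the
Birkhoff averages converge everywhere to one limit. -/
theorem exists_tendsto_birkhoffAverage {X : Type*} {F : X → X} {φ : X → ℝ} {c : ℝ}
    (h : ∀ n x y, birkhoffSum F φ n x ≤ birkhoffSum F φ n y + c) :
    ∃ l : ℝ, ∀ x, Tendsto (fun n : ℕ => birkhoffSum F φ n x / n) atTop (𝓝 l) := by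
  rcases isEmpty_or_nonempty X with hX | ⟨⟨x₀⟩⟩
  · exact ⟨0, fun x => hX.elim x⟩
  -- The added `c` absorbs the change of starting point from `F^[m] x₀` to `x₀`.
  have hsub : Subadditive fun n => birkhoffSum F φ n x₀ + c := by
    intro m n
    have h1 := birkhoffSum_add F φ m n x₀
    have h2 := h n (F^[m] x₀) x₀
    simp only
    linarith
  have hc : 0 ≤ c := by simpa using h 0 x₀ x₀
  have hlow : ∀ n : ℕ, n * (φ x₀ - c) ≤ birkhoffSum F φ n x₀ := by
    intro n
    induction n with
    | zero => simp
    | succ n ih =>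
      have h1 := birkhoffSum_succ F φ n x₀
      have h2 := h 1 x₀ (F^[n] x₀)
      simp only [birkhoffSum_one] at h2
      push_cast
      linarith
  have hbdd : BddBelow (Set.range fun n : ℕ => (birkhoffSum F φ n x₀ + c) / n) := by
    -- The `0` covers `n = 0`, where the quotient is `0` by convention.
    refine ⟨min 0 (φ x₀ - c), ?_⟩
    rintro _ ⟨n, rfl⟩
    rcases Nat.eq_zero_or_pos n with rfl | hn
    · simp
    · refine (min_le_right _ _).trans ?_
      have hn' : (0 : ℝ) < n := by exact_mod_cast hn
      simp only
      rw [le_div_iff₀ hn']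
      linarith [hlow n]
  refine ⟨hsub.lim, fun x => ?_⟩
  have h1 := hsub.tendsto_lim hbdd
  have h2 : Tendsto (fun n : ℕ => (birkhoffSum F φ n x - birkhoffSum F φ n x₀ - c) / (n : ℝ))
      atTop (𝓝 0) := by
    refine squeeze_zero_norm (a := fun n : ℕ => (2 * c) / (n : ℝ)) (fun n => ?_)
      (tendsto_const_div_atTop_nhds_zero_nat (2 * c))
    rw [norm_div, Real.norm_natCast, Real.norm_eq_abs]
    gcongr
    rw [abs_le]
    constructor <;> linarith [h n x x₀, h n x₀ x]
  have h3 := h1.add h2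
  rw [add_zero] at h3
  refine h3.congr fun n => ?_
  rw [← add_div]
  congr 1
  ring

theorem prod_Icc_symm_apply (f : T3 ≃ T3) (J : T3 → ℝ) (M : ℕ) (z : T3) :
    ∏ i ∈ Finset.Icc 1 (M + 1), J (f.symm^[i] (f z)) =
      J z * ∏ i ∈ Finset.Icc 1 M, J (f.symm^[i] z) := by
  induction M with
  | zero => simp
  | succ M ih =>
    rw [Finset.prod_Icc_succ_top (by omega), ih, Finset.prod_Icc_succ_top (by omega), mul_assoc,
      Function.iterate_succ_apply f.symm (M + 1), Equiv.symm_apply_apply]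

/-- The backward orbit of `f^n x` first retraces the `n` points from `f^(n-1) x` to `x`, then
follows the backward orbit of `x`. -/
theorem prod_Icc_symm_iterate (f : T3 ≃ T3) (J : T3 → ℝ) (n N : ℕ) (x : T3) :
    ∏ i ∈ Finset.Icc 1 (N + n), J (f.symm^[i] (f^[n] x)) =
      (∏ i ∈ Finset.range n, J (f^[i] x)) * ∏ i ∈ Finset.Icc 1 N, J (f.symm^[i] x) := by
  induction n with
  | zero => simp
  | succ n ih =>
    rw [← add_assoc, Function.iterate_succ_apply', prod_Icc_symm_apply, ih,
      Finset.prod_range_succ]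
    ring

section Delta

variable {g : RiemannianMetric} {f : T3 ≃ T3} {L : T3 → Submodule ℝ V}

theorem HasDeltaU.iterate {x y : T3} {d : ℝ} (h : HasDeltaU g f L x y d) (n : ℕ) :
    HasDeltaU g f L (f^[n] x) (f^[n] y)
      ((∏ i ∈ Finset.range n, jacobian g f L (f^[i] x)) /
        (∏ i ∈ Finset.range n, jacobian g f L (f^[i] y)) * d) := by
  unfold HasDeltaU at h ⊢
  rw [← tendsto_add_atTop_iff_nat n]
  refine (h.const_mul _).congr fun N => ?_
  simp only [Finset.prod_div_distrib]
  rw [prod_Icc_symm_iterate, prod_Icc_symm_iterate, mul_div_mul_comm]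

theorem HasDeltaS.of_iterate {x y : T3} {d : ℝ} {n : ℕ}
    (h : HasDeltaS g f L (f^[n] x) (f^[n] y) d) :
    HasDeltaS g f L x y
      ((∏ i ∈ Finset.range n, jacobian g f L (f^[i] x)) /
        (∏ i ∈ Finset.range n, jacobian g f L (f^[i] y)) * d) := by
  unfold HasDeltaS at h ⊢
  rw [← tendsto_add_atTop_iff_nat n]
  refine (h.const_mul _).congr fun N => ?_
  rw [add_comm N n, Finset.prod_range_add]
  simp only [Finset.prod_div_distrib, ← Function.iterate_add_apply, add_comm]

/-- Along a continuous invariant line bundle whose iterated Jacobians at the points of a dense set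
are comparable, all points have the same Lyapunov exponent. -/
theorem exists_hasLyapunovExponent (hf : IsC2Diffeo f)
    (hL : ∀ p, Module.finrank ℝ (L p) = 1)
    (hmap : ∀ p, (L p).map (D f p).toLinearMap = L (f p))
    (hcl : IsClosed {x : T3 × V | x.2 ∈ L x.1}) {S : Set T3} (hS : Dense S) {K : ℝ} (hK : 0 < K)
    (h : ∀ x ∈ S, ∀ y ∈ S, ∀ n : ℕ, (∏ i ∈ Finset.range n, jacobian g f L (f^[i] x)) /
        (∏ i ∈ Finset.range n, jacobian g f L (f^[i] y)) ≤ K) :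
    ∃ l : ℝ, ∀ p, HasLyapunovExponent g f L p l := by
  set J := jacobian g f L with hJ
  have hJpos : ∀ p, 0 < J p := fun p => jacobian_pos hf (hL p)
  have hJc : Continuous J := continuous_jacobian hf.1 hL hcl
  have hprod_pos : ∀ (n : ℕ) x, 0 < ∏ i ∈ Finset.range n, J (f^[i] x) := fun n x =>
    Finset.prod_pos fun i _ => hJpos _
  have hprod_c : ∀ n : ℕ, Continuous fun x => ∏ i ∈ Finset.range n, J (f^[i] x) := fun n =>
    continuous_finsetProd _ fun i _ => hJc.comp (hf.1.continuous.iterate i)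
  -- For fixed `n` the inequality is closed in `(x, y)`, so it passes from the dense set `S ×ˢ S` to
  -- all pairs.
  have hall : ∀ (n : ℕ) x y, ∏ i ∈ Finset.range n, J (f^[i] x) ≤
      K * ∏ i ∈ Finset.range n, J (f^[i] y) := by
    intro n x y
    have hclosed : IsClosed {z : T3 × T3 | ∏ i ∈ Finset.range n, J (f^[i] z.1) ≤
        K * ∏ i ∈ Finset.range n, J (f^[i] z.2)} :=
      isClosed_le ((hprod_c n).comp continuous_fst)
        (continuous_const.mul ((hprod_c n).comp continuous_snd))
    have hsub : S ×ˢ S ⊆ {z : T3 × T3 | ∏ i ∈ Finset.range n, J (f^[i] z.1) ≤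
        K * ∏ i ∈ Finset.range n, J (f^[i] z.2)} := by
      rintro ⟨a, b⟩ ⟨ha, hb⟩
      exact (div_le_iff₀ (hprod_pos n b)).1 (h a ha b hb n)
    exact hclosed.closure_subset_iff.2 hsub ((hS.prod hS) (x, y))
  have hlog : ∀ (n : ℕ) x, birkhoffSum f (fun z => Real.log (J z)) n x =
      Real.log (∏ i ∈ Finset.range n, J (f^[i] x)) := fun n x =>
    (Real.log_prod fun i _ => (hJpos _).ne').symm
  obtain ⟨l, hl⟩ := exists_tendsto_birkhoffAverage (F := f) (φ := fun z => Real.log (J z))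
    (c := Real.log K) (by
      intro n x y
      rw [hlog, hlog, add_comm, ← Real.log_mul hK.ne' (hprod_pos n y).ne']
      exact Real.log_le_log (hprod_pos n x) (hall n x y))
  refine ⟨l, fun p v hv hv0 => ?_⟩
  have h1 := (hl p).add (tendsto_const_div_atTop_nhds_zero_nat (Real.log (g.norm p v)))
  rw [add_zero] at h1
  refine h1.congr fun n => ?_
  rw [norm_D_iterate hf.1 hL hmap n p hv, ← hJ,
    Real.log_mul (hprod_pos n p).ne' (g.norm_pos p hv0).ne', hlog]
  ring

end Delta

end PHTorus

theorem proposition4p4 (g : PHTorus.RiemannianMetric) (f : PHTorus.T3 ≃ PHTorus.T3)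
    (hf : PHTorus.IsC2Diffeo f)
    (E : PHTorus.Label → PHTorus.T3 → Submodule ℝ PHTorus.V)
    (hE : PHTorus.IsPartiallyHyperbolicSplitting g f E)
    (σ : PHTorus.Label) (hσ : σ = PHTorus.Label.s ∨ σ = PHTorus.Label.u)
    (S : Set PHTorus.T3) (hS : Dense S)
    (hΔ : ∃ K : ℝ, 1 < K ∧ ∀ y₁ ∈ S, ∀ y₂ ∈ S, ∀ n : ℕ,
      ∃ d : ℝ, PHTorus.HasDelta g f E σ (f^[n] y₁) (f^[n] y₂) d ∧ K⁻¹ ≤ d ∧ d ≤ K) :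
    ∃ l : ℝ, ∀ p ∈ Function.periodicPts f, PHTorus.HasLyapunovExponent g f (E σ) p l := by
  obtain ⟨K, hK, H⟩ := hΔ
  have hK0 : 0 < K := one_pos.trans hK
  -- The ratio `r = d' / d` is at most `K / K⁻¹`.
  have ratio_le : ∀ {r d d' : ℝ}, d' = r * d → K⁻¹ ≤ d → d' ≤ K → r ≤ K * K := by
    rintro r d _ rfl hd hd'
    have hd0 : 0 < d := (inv_pos.2 hK0).trans_le hd
    have h1 : 1 ≤ K * d := by
      have := mul_le_mul_of_nonneg_left hd hK0.le
      rwa [mul_inv_cancel₀ hK0.ne'] at this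
    have h2 : r ≤ K / d := (le_div_iff₀ hd0).2 hd'
    refine h2.trans ((div_le_iff₀ hd0).2 ?_)
    nlinarith
  suffices h : IsClosed {x : PHTorus.T3 × PHTorus.V | x.2 ∈ E σ x.1} ∧
      ∀ x ∈ S, ∀ y ∈ S, ∀ n : ℕ,
        (∏ i ∈ Finset.range n, PHTorus.jacobian g f (E σ) (f^[i] x)) /
          (∏ i ∈ Finset.range n, PHTorus.jacobian g f (E σ) (f^[i] y)) ≤ K * K by
    obtain ⟨l, hl⟩ := PHTorus.exists_hasLyapunovExponent hf (hE.finrank_eq_one σ) (hE.map_eq σ)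
      h.1 hS (mul_pos hK0 hK0) h.2
    exact ⟨l, fun p _ => hl p⟩
  rcases hσ with rfl | rfl
  · refine ⟨hE.isClosed_stable hf, fun x hx y hy n => ?_⟩
    -- Here the ratio is `Δ` at time `0` over `Δ` at time `n`; in the unstable case it is the
    -- inverse quotient, so the two bounds swap roles.
    obtain ⟨d₀, h₀, -, hd₀⟩ := H x hx y hy 0
    obtain ⟨d, h, hd, -⟩ := H x hx y hy n
    exact ratio_le (tendsto_nhds_unique h₀ (PHTorus.HasDeltaS.of_iterate h)) hd hd₀
  · refine ⟨hE.isClosed_unstable hf, fun x hx y hy n => ?_⟩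
    obtain ⟨d₀, h₀, hd₀, -⟩ := H x hx y hy 0
    obtain ⟨d, h, -, hd⟩ := H x hx y hy n
    exact ratio_le (tendsto_nhds_unique h (PHTorus.HasDeltaU.iterate h₀ n)) hd₀ hd
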